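/- Let $\Phi$ be the standard normal distribution function and, for $c>0$, let $$G(c)=\frac12\left(1-\frac12\cdot\frac{1-\Phi(c^{-1/2})}{1-\Phi(\sqrt2)}\right).$$ Let $v_1,\dots,v_n$ be real numbers with $\sum_{i=1}^n v_i^2\le 1$, let $\epsilon_1,\dots,\epsilon_n$ be independent Rademacher random variables (each equal to $1$ or $-1$ with probability $\frac12$), and let $S=\sum_{i=1}^n v_i\epsilon_i$. Then $$P(|S|\le 1)\;\ge\; G\left(\tfrac14\right)=\frac12-\frac{1-\Phi(2)}{4\,(1-\Phi(\sqrt2))},$$ and $0.42768<G(\tfrac14)<0.42769$. -/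

import Mathlib

open MeasureTheory ProbabilityTheory

/-- The Rademacher distribution: mass `1/2` at each of `1` and `-1`. -/
noncomputable def rademacherMeasure : Measure ℝ :=
  (2⁻¹ : ENNReal) • Measure.dirac (1 : ℝ) + (2⁻¹ : ENNReal) • Measure.dirac (-1 : ℝ)

/-- The standard normal distribution function. -/
noncomputable def stdNormalCDF (x : ℝ) : ℝ := cdf (gaussianReal 0 1) x

/-- The function `G(c) = (1/2) (1 - (1/2) (1 - Φ(c^{-1/2})) / (1 - Φ(√2)))`, meant for `c > 0`. -/
noncomputable def boundG (c : ℝ) : ℝ :=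
  1 / 2 * (1 - 1 / 2 * ((1 - stdNormalCDF (c ^ (-(1 / 2) : ℝ))) / (1 - stdNormalCDF (√2))))

/-! Read the signed sum as a walk that reveals one sign at a time, in an order of one's choosing. By
symmetry, a walk at `x` in `[-1, 1]` ends in `[-1, 1]` with probability at least `1/2`, minus the
chance that the remaining increment is at least `1 + |x|`. It pays to stop only when `|x|` is close
to 1, since the increment must then be nearly 2. If the walk never gets that far out, two reserved
weights, played last, bring it home with probability at least `1/2` and nothing is lost
(`half_le_signProb_pair`).

The losses are controlled by `signProb_ge_le_gaussTail`: beyond `√2` standard deviations, the tail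
of a signed sum is at most 3.55 times the Gaussian tail. Between `√2` and `√3` this follows from
Chebyshev and eighth-moment bounds. Beyond `√3` it follows by induction on the number of weights,
because replacing a Gaussian component by a sign of the same variance does not increase the Gaussian
tail there (`gaussTail_add_gaussTail_le`).

With weights sorted decreasingly in absolute value, `a₂, a₄` are played first and `a₃, a₁` last. If
`a₅ ≤ 0.339`, all stopping losses fit inside one tail event of the whole sum. Otherwise the large
weights leave little variance, and each loss is bounded separately. Either way at most 0.0723 is
lost, slightly less than `1/2 - G(1/4)`. -/

/-! ### Averages over signs -/

/-- The average of `f` over all signed sums of the entries of `l`. -/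
noncomputable def signAvg : List ℝ → (ℝ → ℝ) → ℝ
  | [], f => f 0
  | a :: l, f => (signAvg l (fun s => f (a + s)) + signAvg l (fun s => f (-a + s))) / 2

@[simp] lemma signAvg_nil (f : ℝ → ℝ) : signAvg [] f = f 0 := rfl

lemma signAvg_cons (a : ℝ) (l : List ℝ) (f : ℝ → ℝ) :
    signAvg (a :: l) f =
      (signAvg l (fun s => f (a + s)) + signAvg l (fun s => f (-a + s))) / 2 := rfl

lemma signAvg_mono (l : List ℝ) {f g : ℝ → ℝ} (h : ∀ s, f s ≤ g s) :
    signAvg l f ≤ signAvg l g := by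
  induction l generalizing f g with
  | nil => exact h 0
  | cons a l ih =>
    rw [signAvg_cons, signAvg_cons]
    have h1 := ih (f := fun s => f (a + s)) (g := fun s => g (a + s)) fun s => h _
    have h2 := ih (f := fun s => f (-a + s)) (g := fun s => g (-a + s)) fun s => h _
    linarith

lemma signAvg_add (l : List ℝ) (f g : ℝ → ℝ) :
    signAvg l (fun s => f s + g s) = signAvg l f + signAvg l g := by
  induction l generalizing f g with
  | nil => rfl
  | cons a l ih =>
    simp only [signAvg_cons]
    rw [ih (fun s => f (a + s)) (fun s => g (a + s)),
      ih (fun s => f (-a + s)) (fun s => g (-a + s))]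
    ring

lemma signAvg_const_mul (l : List ℝ) (c : ℝ) (f : ℝ → ℝ) :
    signAvg l (fun s => c * f s) = c * signAvg l f := by
  induction l generalizing f with
  | nil => rfl
  | cons a l ih =>
    simp only [signAvg_cons]
    rw [ih (fun s => f (a + s)), ih (fun s => f (-a + s))]
    ring

lemma signAvg_const (l : List ℝ) (c : ℝ) : signAvg l (fun _ => c) = c := by
  induction l with
  | nil => rfl
  | cons a l ih => rw [signAvg_cons, ih]; ring

lemma signAvg_neg (l : List ℝ) (f : ℝ → ℝ) : signAvg l (fun s => f (-s)) = signAvg l f := by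
  induction l generalizing f with
  | nil => simp
  | cons a l ih =>
    simp only [signAvg_cons]
    have h1 : (fun s : ℝ => f (-(a + s))) = fun s => (fun s => f (-a + s)) (-s) := by
      funext s; ring_nf
    have h2 : (fun s : ℝ => f (-(-a + s))) = fun s => (fun s => f (a + s)) (-s) := by
      funext s; ring_nf
    rw [h1, h2, ih (fun s => f (-a + s)), ih (fun s => f (a + s)), add_comm]

/-- This is what allows the order in which the walk plays its weights to be chosen freely. -/
lemma signAvg_perm {l l' : List ℝ} (h : l.Perm l') (f : ℝ → ℝ) : signAvg l f = signAvg l' f := by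
  induction h generalizing f with
  | nil => rfl
  | cons a _ ih => rw [signAvg_cons, signAvg_cons, ih, ih]
  | swap a b l =>
    simp only [signAvg_cons]
    have h (x y : ℝ) : (fun s : ℝ => f (x + (y + s))) = fun s => f (y + (x + s)) := by
      funext s; ring_nf
    rw [h b a, h b (-a), h (-b) a, h (-b) (-a)]
    ring
  | trans _ _ h1 h2 => rw [h1, h2]

lemma signAvg_map_mul (l : List ℝ) (c : ℝ) (f : ℝ → ℝ) :
    signAvg (l.map (c * ·)) f = signAvg l (fun s => f (c * s)) := by
  induction l generalizing f with
  | nil => simp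
  | cons a l ih => simp [signAvg_cons, ih, mul_add]

lemma signAvg_map_abs (l : List ℝ) (f : ℝ → ℝ) : signAvg (l.map (|·|)) f = signAvg l f := by
  induction l generalizing f with
  | nil => simp
  | cons a l ih =>
    simp only [List.map_cons, signAvg_cons, ih]
    rcases abs_choice a with h | h <;> rw [h]
    rw [neg_neg, add_comm]

/-! ### Power sums and even moments up to order eight -/

/-- The sum of the `k`-th powers of the entries of `l`. -/
noncomputable def powSum (k : ℕ) (l : List ℝ) : ℝ := (l.map (· ^ k)).sum

@[simp] lemma powSum_nil (k : ℕ) : powSum k [] = 0 := rfl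

@[simp] lemma powSum_cons (k : ℕ) (a : ℝ) (l : List ℝ) :
    powSum k (a :: l) = a ^ k + powSum k l := by simp [powSum]

lemma powSum_nonneg {k : ℕ} (hk : Even k) (l : List ℝ) : 0 ≤ powSum k l := by
  induction l with
  | nil => simp
  | cons a l ih => rw [powSum_cons]; have := hk.pow_nonneg a; linarith

lemma powSum_perm {k : ℕ} {l l' : List ℝ} (h : l.Perm l') : powSum k l = powSum k l' :=
  (h.map _).sum_eq

lemma powSum_map_mul (k : ℕ) (c : ℝ) (l : List ℝ) :
    powSum k (l.map (c * ·)) = c ^ k * powSum k l := by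
  induction l with
  | nil => simp
  | cons a l ih => simp only [List.map_cons, powSum_cons, ih]; ring

lemma powSum_map_abs (l : List ℝ) : powSum 2 (l.map (|·|)) = powSum 2 l := by
  induction l with
  | nil => simp
  | cons a l ih => simp only [List.map_cons, powSum_cons, ih, sq_abs]

/-- Averaging over the sign of `a` cancels the odd powers of `s`, so even polynomials of degree
eight are preserved. This drives the induction for the moment formula. -/
lemma signAvg_even_poly_cons (a : ℝ) (l : List ℝ) (c₀ c₁ c₂ c₃ c₄ : ℝ) :
    signAvg (a :: l) (fun s => c₀ + c₁ * s ^ 2 + c₂ * s ^ 4 + c₃ * s ^ 6 + c₄ * s ^ 8) =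
    signAvg l (fun s =>
      (c₀ + c₁ * a ^ 2 + c₂ * a ^ 4 + c₃ * a ^ 6 + c₄ * a ^ 8) +
      (c₁ + 6 * c₂ * a ^ 2 + 15 * c₃ * a ^ 4 + 28 * c₄ * a ^ 6) * s ^ 2 +
      (c₂ + 15 * c₃ * a ^ 2 + 70 * c₄ * a ^ 4) * s ^ 4 +
      (c₃ + 28 * c₄ * a ^ 2) * s ^ 6 + c₄ * s ^ 8) := by
  rw [signAvg_cons, ← signAvg_add, div_eq_inv_mul, ← signAvg_const_mul]
  congr 1
  funext s
  ring

/-- The average of an even polynomial of degree eight in terms of power sums. -/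
lemma signAvg_even_poly (l : List ℝ) (c₀ c₁ c₂ c₃ c₄ : ℝ) :
    signAvg l (fun s => c₀ + c₁ * s ^ 2 + c₂ * s ^ 4 + c₃ * s ^ 6 + c₄ * s ^ 8) =
    c₀ + c₁ * powSum 2 l + c₂ * (3 * powSum 2 l ^ 2 - 2 * powSum 4 l) +
      c₃ * (15 * powSum 2 l ^ 3 - 30 * powSum 2 l * powSum 4 l + 16 * powSum 6 l) +
      c₄ * (105 * powSum 2 l ^ 4 - 420 * powSum 2 l ^ 2 * powSum 4 l +
        448 * powSum 2 l * powSum 6 l + 140 * powSum 4 l ^ 2 - 272 * powSum 8 l) := by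
  -- The numbers -2, 16, -272 in the formula are the Rademacher cumulants of orders 4, 6, 8.
  -- Cumulants add over independent terms, hence the power sums.
  induction l generalizing c₀ c₁ c₂ c₃ c₄ with
  | nil => simp
  | cons a l ih =>
    rw [signAvg_even_poly_cons, ih]
    simp only [powSum_cons]
    ring

lemma signAvg_sq (l : List ℝ) : signAvg l (fun s => s ^ 2) = powSum 2 l := by
  have := signAvg_even_poly l 0 1 0 0 0
  simpa using this

/-- Sum of `a ^ 2 * (a ^ 2 - t) ^ 2 ≥ 0`; optimising `t` gives Cauchy–Schwarz. -/
lemma powSum_four_mul_le (l : List ℝ) (t : ℝ) :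
    2 * t * powSum 4 l ≤ powSum 6 l + t ^ 2 * powSum 2 l := by
  induction l with
  | nil => simp
  | cons a l ih =>
    simp only [powSum_cons]
    nlinarith [mul_nonneg (sq_nonneg a) (sq_nonneg (a ^ 2 - t))]

lemma powSum_four_sq_le {l : List ℝ} (h : powSum 2 l = 1) : powSum 4 l ^ 2 ≤ powSum 6 l := by
  have := powSum_four_mul_le l (powSum 4 l)
  rw [h] at this
  linarith

lemma sq_le_powSum_two {a : ℝ} {l : List ℝ} (h : a ∈ l) : a ^ 2 ≤ powSum 2 l := by
  induction l with
  | nil => simp at h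
  | cons b l ih =>
    rw [powSum_cons]
    rcases List.mem_cons.1 h with rfl | h
    · have := powSum_nonneg (k := 2) even_two l; linarith
    · have := ih h; have := sq_nonneg b; linarith

/-- The left side averages a cubic in `b = a ^ 2` with weights `a ^ 2`, so a pointwise bound
suffices. -/
lemma powSum_combination_le (l : List ℝ) (A B F K : ℝ)
    (h : ∀ a ∈ l, -A * a ^ 2 + B * (a ^ 2) ^ 2 - F * (a ^ 2) ^ 3 ≤ K) :
    -A * powSum 4 l + B * powSum 6 l - F * powSum 8 l ≤ K * powSum 2 l := by
  induction l with
  | nil => simp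
  | cons a l ih =>
    simp only [powSum_cons]
    have h1 := ih fun b hb => h b (List.mem_cons_of_mem _ hb)
    have h2 := mul_le_mul_of_nonneg_left (h a List.mem_cons_self) (sq_nonneg a)
    nlinarith

/-- An even polynomial of degree eight, averaged over signed sums of a unit vector, is bounded by
the values of a cubic on the unit interval. -/
lemma signAvg_even_poly_le {l : List ℝ} (hl : powSum 2 l = 1) {c₀ c₁ c₂ c₃ c₄ β : ℝ} (h4 : 0 ≤ c₄)
    (h : ∀ b : ℝ, 0 ≤ b → b ≤ 1 →
      (c₀ + c₁ + 3 * c₂ + 15 * c₃ + 105 * c₄) - (2 * c₂ + 30 * c₃ + 420 * c₄) * b +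
        (16 * c₃ + 588 * c₄) * b ^ 2 - 272 * c₄ * b ^ 3 ≤ β) :
    signAvg l (fun s => c₀ + c₁ * s ^ 2 + c₂ * s ^ 4 + c₃ * s ^ 6 + c₄ * s ^ 8) ≤ β := by
  rw [signAvg_even_poly, hl]
  have h1 := powSum_combination_le l (2 * c₂ + 30 * c₃ + 420 * c₄) (16 * c₃ + 588 * c₄)
    (272 * c₄) (β - (c₀ + c₁ + 3 * c₂ + 15 * c₃ + 105 * c₄)) fun a ha => by
      have := h (a ^ 2) (sq_nonneg a) (hl ▸ sq_le_powSum_two ha)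
      linarith
  -- Replacing `140 * powSum 4 l ^ 2` by `140 * powSum 6 l` makes everything linear in the power
  -- sums; hence 588 = 448 + 140.
  have h2 := mul_le_mul_of_nonneg_left (powSum_four_sq_le hl) h4
  rw [hl] at h1
  nlinarith

/-! ### Probabilities of signed sums and moment tail bounds -/

/-- The proportion of signed sums of the entries of `l` that lie in `A`. -/
noncomputable def signProb (l : List ℝ) (A : Set ℝ) : ℝ := signAvg l (A.indicator 1)

lemma signProb_cons (a : ℝ) (l : List ℝ) (A : Set ℝ) :
    signProb (a :: l) A = (signProb l {s | a + s ∈ A} + signProb l {s | -a + s ∈ A}) / 2 := rfl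

lemma signProb_mono (l : List ℝ) {A B : Set ℝ} (h : A ⊆ B) : signProb l A ≤ signProb l B :=
  signAvg_mono l fun s => Set.indicator_le_indicator_of_subset h (fun _ => zero_le_one) s

lemma signProb_nonneg (l : List ℝ) (A : Set ℝ) : 0 ≤ signProb l A := by
  rw [← signAvg_const l 0]
  exact signAvg_mono l fun s => Set.indicator_nonneg (fun _ _ => zero_le_one) s

lemma signProb_neg (l : List ℝ) (A : Set ℝ) : signProb l {s | -s ∈ A} = signProb l A :=
  signAvg_neg l (A.indicator 1)

lemma signProb_union_le (l : List ℝ) (A B : Set ℝ) :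
    signProb l (A ∪ B) ≤ signProb l A + signProb l B := by
  rw [signProb, signProb, signProb, ← signAvg_add]
  refine signAvg_mono l fun s => ?_
  by_cases h1 : s ∈ A <;> by_cases h2 : s ∈ B <;> simp [h1, h2]

lemma signProb_add_compl (l : List ℝ) (A : Set ℝ) : signProb l A + signProb l Aᶜ = 1 := by
  rw [signProb, signProb, ← signAvg_add, ← signAvg_const l 1]
  congr 1
  funext s
  by_cases h1 : s ∈ A <;> simp [h1]

lemma signProb_abs (l : List ℝ) {θ : ℝ} (h : 0 < θ) :
    signProb l {s | θ ≤ |s|} = 2 * signProb l {s | θ ≤ s} := by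
  rw [two_mul]
  nth_rw 2 [← signProb_neg]
  rw [signProb, signProb, signProb, ← signAvg_add]
  congr 1
  funext s
  rcases le_total 0 s with hs | hs
  · have : ¬ θ ≤ -s := by linarith
    by_cases h1 : θ ≤ s <;> simp [Set.indicator, abs_of_nonneg hs, h1, this]
  · have : ¬ θ ≤ s := by linarith
    by_cases h1 : θ ≤ -s <;> simp [Set.indicator, abs_of_nonpos hs, h1, this]

lemma signProb_ge_le_half_signAvg (l : List ℝ) {θ : ℝ} (h : 0 < θ) {f : ℝ → ℝ} (hf : ∀ s, 0 ≤ f s)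
    (hf1 : ∀ s, θ ≤ |s| → 1 ≤ f s) : signProb l {s | θ ≤ s} ≤ signAvg l f / 2 := by
  have h1 : signProb l {s | θ ≤ |s|} ≤ signAvg l f := by
    refine signAvg_mono l fun s => ?_
    by_cases hs : θ ≤ |s|
    · simpa [hs] using hf1 s hs
    · simpa [hs] using hf s
  rw [signProb_abs l h] at h1
  linarith

/-- Chebyshev's inequality for signed sums. -/
lemma signProb_ge_le_sq (l : List ℝ) {θ : ℝ} (h : 0 < θ) :
    signProb l {s | θ ≤ s} ≤ powSum 2 l / (2 * θ ^ 2) := by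
  have := signProb_ge_le_half_signAvg l h (f := fun s => (1 / θ ^ 2) * s ^ 2)
    (fun s => by positivity) fun s hs => by
      rw [one_div_mul_eq_div, one_le_div (by positivity), ← sq_abs s]
      gcongr
  rw [signAvg_const_mul, signAvg_sq] at this
  calc _ ≤ _ := this
    _ = _ := by field_simp

lemma signProb_map_mul (l : List ℝ) {c : ℝ} (hc : 0 < c) (θ : ℝ) :
    signProb (l.map (c * ·)) {s | c * θ ≤ s} = signProb l {s | θ ≤ s} := by
  rw [signProb, signAvg_map_mul, signProb]
  congr 1
  funext s
  simp [Set.indicator, mul_le_mul_iff_right₀ hc]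

lemma signProb_ge_le_of_poly {l : List ℝ} (hl : powSum 2 l = 1) {c₀ c₁ c₂ c₃ c₄ β y θ : ℝ}
    (hy : 0 < y) (hθ : y ≤ θ) (h4 : 0 ≤ c₄)
    (h : ∀ b : ℝ, 0 ≤ b → b ≤ 1 →
      (c₀ + c₁ + 3 * c₂ + 15 * c₃ + 105 * c₄) - (2 * c₂ + 30 * c₃ + 420 * c₄) * b +
        (16 * c₃ + 588 * c₄) * b ^ 2 - 272 * c₄ * b ^ 3 ≤ β)
    (h0 : ∀ u : ℝ, 0 ≤ u → 0 ≤ c₀ + c₁ * u + c₂ * u ^ 2 + c₃ * u ^ 3 + c₄ * u ^ 4)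
    (h1 : ∀ u : ℝ, y ^ 2 ≤ u → 1 ≤ c₀ + c₁ * u + c₂ * u ^ 2 + c₃ * u ^ 3 + c₄ * u ^ 4) :
    signProb l {s | θ ≤ s} ≤ β / 2 := by
  have := signProb_ge_le_half_signAvg l (hy.trans_le hθ)
    (f := fun s => c₀ + c₁ * s ^ 2 + c₂ * s ^ 4 + c₃ * s ^ 6 + c₄ * s ^ 8)
    (fun s => by have := h0 (s ^ 2) (sq_nonneg s); ring_nf at this ⊢; exact this)
    (fun s hs => by
      have := h1 (s ^ 2) (by rw [← sq_abs s]; exact pow_le_pow_left₀ hy.le (hθ.trans hs) 2)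
      ring_nf at this ⊢; exact this)
  linarith [signAvg_even_poly_le hl h4 h]

/-- A tail bound from the polynomial `(u - a) ^ 2 * (p * u ^ 2 + q * u + r)` in the square `u` of a
signed sum. -/
lemma signProb_ge_le_of_factored {l : List ℝ} (hl : powSum 2 l = 1) {a p q r β y θ : ℝ}
    (hy : 0 < y) (hθ : y ≤ θ) (hp : 0 < p) (hdisc : q ^ 2 ≤ 4 * p * r)
    (h : ∀ b : ℝ, 0 ≤ b → b ≤ 1 →
      (r * a ^ 2 + (q * a ^ 2 - 2 * a * r) + 3 * (p * a ^ 2 - 2 * a * q + r) +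
        15 * (q - 2 * a * p) + 105 * p) -
        (2 * (p * a ^ 2 - 2 * a * q + r) + 30 * (q - 2 * a * p) + 420 * p) * b +
        (16 * (q - 2 * a * p) + 588 * p) * b ^ 2 - 272 * p * b ^ 3 ≤ β)
    (h1 : ∀ u : ℝ, y ^ 2 ≤ u → 1 ≤ (u - a) ^ 2 * (p * u ^ 2 + q * u + r)) :
    signProb l {s | θ ≤ s} ≤ β / 2 := by
  have key (u : ℝ) : (u - a) ^ 2 * (p * u ^ 2 + q * u + r) = r * a ^ 2 +
      (q * a ^ 2 - 2 * a * r) * u + (p * a ^ 2 - 2 * a * q + r) * u ^ 2 +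
      (q - 2 * a * p) * u ^ 3 + p * u ^ 4 := by ring
  refine signProb_ge_le_of_poly hl hy hθ hp.le h (fun u _ => ?_) fun u hu => ?_
  · rw [← key]
    refine mul_nonneg (sq_nonneg _) ?_
    -- Complete the square: `4 * p` times the quadratic is `(2 * p * u + q) ^ 2 + (4 * p * r - q ^
    -- 2)`.
    by_contra! hneg
    nlinarith [sq_nonneg (2 * p * u + q)]
  · rw [← key]
    exact h1 u hu

lemma signProb_ge_le_of_159 {l : List ℝ} (hl : powSum 2 l = 1) {θ : ℝ} (hθ : 159 / 100 ≤ θ) :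
    signProb l {s | θ ≤ s} ≤ 1715 / 10000 := by
  -- The coefficients make the quartic just exceed 1 at `u = 1.59 ^ 2`. The cubic in `b` peaks near
  -- 0.41, which explains the square in the hint.
  have := signProb_ge_le_of_factored (a := 9 / 40) (p := 169 / 100000) (q := -43 / 1000)
    (r := 287 / 1000) (β := 343 / 1000) hl (by norm_num) hθ (by norm_num) (by norm_num)
    (fun b hb0 hb1 => by
      nlinarith [mul_nonneg hb0 (sq_nonneg (b - 41 / 100)), sq_nonneg (b - 41 / 100)])
    (fun u hu => by
      have h0 : 0 ≤ u - 25281 / 10000 := by norm_num at hu; linarith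
      have h1 := mul_nonneg h0 (sq_nonneg (u - 51 / 4))
      nlinarith [mul_nonneg h1 h0, mul_nonneg h0 h0])
  linarith

lemma signProb_ge_le_of_166 {l : List ℝ} (hl : powSum 2 l = 1) {θ : ℝ} (hθ : 166 / 100 ≤ θ) :
    signProb l {s | θ ≤ s} ≤ 1477 / 10000 := by
  -- Same design: the quartic just exceeds 1 at `u = 1.66 ^ 2`, and the cubic peaks near `b = 0.37`.
  have := signProb_ge_le_of_factored (a := 27 / 100) (p := 138 / 100000) (q := -367 / 10000)
    (r := 253 / 1000) (β := 2954 / 10000) hl (by norm_num) hθ (by norm_num) (by norm_num)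
    (fun b hb0 hb1 => by
      nlinarith [mul_nonneg hb0 (sq_nonneg (b - 37 / 100)), sq_nonneg (b - 37 / 100)])
    (fun u hu => by
      have h0 : 0 ≤ u - 27556 / 10000 := by norm_num at hu; linarith
      have h1 := mul_nonneg h0 (sq_nonneg (u - 131 / 10))
      nlinarith [mul_nonneg h1 h0, mul_nonneg h0 h0])
  linarith

/-! ### The Gaussian tail and its numerical values -/

/-- The upper tail `1 - Φ(x)` of the standard normal distribution, as an explicit integral. -/
noncomputable def gaussTail (x : ℝ) : ℝ :=
  1 / 2 - (√(2 * Real.pi))⁻¹ * ∫ t in (0 : ℝ)..x, Real.exp (-(t ^ 2 / 2))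

lemma one_sub_stdNormalCDF (x : ℝ) : 1 - stdNormalCDF x = gaussTail x := by
  have hpdf : gaussianPDFReal 0 1 = fun t => (√(2 * Real.pi))⁻¹ * Real.exp (-(t ^ 2 / 2)) := by
    funext t
    simp only [gaussianPDFReal_def, NNReal.coe_one, mul_one, sub_zero]
    congr 2
    ring
  have hint := integrable_gaussianPDFReal 0 1
  have hcdf : stdNormalCDF x = ∫ t in Set.Iic x, gaussianPDFReal 0 1 t := by
    rw [stdNormalCDF, cdf_eq_real, measureReal_def, gaussianReal_apply_eq_integral 0 one_ne_zero,
      ENNReal.toReal_ofReal]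
    exact integral_nonneg fun t => gaussianPDFReal_nonneg 0 1 t
  have h1 : ∫ t in Set.Ioi (0 : ℝ), gaussianPDFReal 0 1 t = 1 / 2 := by
    have h2 : gaussianPDFReal 0 1 = fun t => (√(2 * Real.pi))⁻¹ * Real.exp (-(1 / 2) * t ^ 2) := by
      rw [hpdf]; funext t; congr 2; ring
    rw [h2, integral_const_mul, integral_gaussian_Ioi]
    have : Real.pi / (1 / 2) = 2 * Real.pi := by ring
    rw [this]
    have : √(2 * Real.pi) ≠ 0 := by positivity
    field_simp
  have h2 : (∫ t in Set.Iic (0 : ℝ), gaussianPDFReal 0 1 t) +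
      ∫ t in Set.Ioi (0 : ℝ), gaussianPDFReal 0 1 t = 1 := by
    rw [← integral_gaussianPDFReal_eq_one 0 (one_ne_zero : (1 : NNReal) ≠ 0), ← Set.compl_Iic]
    exact integral_add_compl measurableSet_Iic hint
  have h3 := intervalIntegral.integral_Iic_sub_Iic (μ := volume) (a := 0) (b := x)
    hint.integrableOn hint.integrableOn
  have h4 : ∫ t in (0 : ℝ)..x, gaussianPDFReal 0 1 t =
      (√(2 * Real.pi))⁻¹ * ∫ t in (0 : ℝ)..x, Real.exp (-(t ^ 2 / 2)) := by
    rw [hpdf, intervalIntegral.integral_const_mul]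
  rw [gaussTail, hcdf]
  linarith

lemma continuous_exp_neg_half_sq : Continuous fun t : ℝ => Real.exp (-(t ^ 2 / 2)) := by fun_prop

lemma hasDerivAt_integral_exp_neg_half_sq (x : ℝ) :
    HasDerivAt (fun x => ∫ t in (0 : ℝ)..x, Real.exp (-(t ^ 2 / 2))) (Real.exp (-(x ^ 2 / 2))) x :=
  intervalIntegral.integral_hasDerivAt_right
    (continuous_exp_neg_half_sq.intervalIntegrable _ _)
    (continuous_exp_neg_half_sq.stronglyMeasurableAtFilter _ _)
    continuous_exp_neg_half_sq.continuousAt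

lemma hasDerivAt_gaussTail (x : ℝ) :
    HasDerivAt gaussTail (-((√(2 * Real.pi))⁻¹ * Real.exp (-(x ^ 2 / 2)))) x :=
  ((hasDerivAt_integral_exp_neg_half_sq x).const_mul _).const_sub _

lemma antitone_gaussTail : Antitone gaussTail :=
  antitone_of_hasDerivAt_nonpos hasDerivAt_gaussTail fun x => by
    have : 0 ≤ (√(2 * Real.pi))⁻¹ * Real.exp (-(x ^ 2 / 2)) := by positivity
    simpa using this

lemma gaussTail_nonneg (x : ℝ) : 0 ≤ gaussTail x := by
  rw [← one_sub_stdNormalCDF, stdNormalCDF]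
  linarith [cdf_le_one (gaussianReal 0 1) x]

/-- Each signed remainder vanishes at 0 and has the previous signed remainder as derivative, so
nonnegativity propagates by monotonicity. -/
lemma alternating_exp_remainder_nonneg (n : ℕ) {u : ℝ} (hu : 0 ≤ u) :
    0 ≤ (-1) ^ n * (Real.exp (-u) - ∑ k ∈ Finset.range n, (-u) ^ k / k.factorial) := by
  induction n generalizing u with
  | zero => simp [Real.exp_nonneg]
  | succ n ih =>
    have hd (x : ℝ) : HasDerivAt (fun x : ℝ => (-1 : ℝ) ^ (n + 1) *
        (Real.exp (-x) - ∑ k ∈ Finset.range (n + 1), (-x) ^ k / k.factorial))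
        ((-1) ^ n * (Real.exp (-x) - ∑ k ∈ Finset.range n, (-x) ^ k / k.factorial)) x := by
      have h1 : HasDerivAt (fun x : ℝ => ∑ k ∈ Finset.range (n + 1), (-x) ^ k / k.factorial)
          (-∑ k ∈ Finset.range n, (-x) ^ k / k.factorial) x := by
        simp_rw [Finset.sum_range_succ', pow_zero]
        have : ∀ k ∈ Finset.range n, HasDerivAt (fun x : ℝ => (-x) ^ (k + 1) / (k + 1).factorial)
            (-((-x) ^ k / k.factorial)) x := fun k _ => by
          have h := (((hasDerivAt_id x).neg).pow (k + 1)).div_const ((k + 1).factorial : ℝ)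
          refine h.congr_deriv ?_
          rw [Nat.factorial_succ]
          have : (k.factorial : ℝ) ≠ 0 := by positivity
          have h2 : (k : ℝ) + 1 ≠ 0 := by positivity
          push_cast
          field_simp
          simp
        have h := (HasDerivAt.fun_sum this).add_const (1 / ((Nat.factorial 0 : ℕ) : ℝ))
        rw [Finset.sum_neg_distrib] at h
        exact h
      have h2 := (((hasDerivAt_id x).neg.exp).sub h1).const_mul ((-1 : ℝ) ^ (n + 1))
      refine h2.congr_deriv ?_
      rw [pow_succ]
      simp
      ring
    have hmono : MonotoneOn (fun x : ℝ => (-1 : ℝ) ^ (n + 1) *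
        (Real.exp (-x) - ∑ k ∈ Finset.range (n + 1), (-x) ^ k / k.factorial)) (Set.Ici 0) := by
      refine monotoneOn_of_deriv_nonneg (convex_Ici 0)
        (fun x _ => (hd x).continuousAt.continuousWithinAt)
        (fun x _ => (hd x).differentiableAt.differentiableWithinAt) fun x hx => ?_
      rw [(hd x).deriv]
      exact ih (interior_subset hx)
    have := hmono (Set.self_mem_Ici) hu hu
    simpa [Finset.sum_range_succ'] using this

/-- The partial sums of the Maclaurin series of `∫ t in 0..x, exp (-t ^ 2 / 2)`. -/
noncomputable def erfSeries (n : ℕ) (x : ℝ) : ℝ :=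
  x * ∑ k ∈ Finset.range n, (-(x ^ 2 / 2)) ^ k / (k.factorial * (2 * k + 1))

/-- The derivative is the signed exponential remainder at `x ^ 2 / 2`. Even partial sums therefore
underestimate the integral and odd ones overestimate it. -/
lemma alternating_erfSeries_remainder_nonneg (n : ℕ) {x : ℝ} (hx : 0 ≤ x) :
    0 ≤ (-1) ^ n * ((∫ t in (0 : ℝ)..x, Real.exp (-(t ^ 2 / 2))) - erfSeries n x) := by
  have hs (x : ℝ) : HasDerivAt (erfSeries n)
      (∑ k ∈ Finset.range n, (-(x ^ 2 / 2)) ^ k / k.factorial) x := by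
    have h (k : ℕ) : HasDerivAt
        (fun x : ℝ => (-1 / 2 : ℝ) ^ k / (k.factorial * (2 * k + 1)) * x ^ (2 * k + 1))
        ((-(x ^ 2 / 2)) ^ k / k.factorial) x := by
      refine ((hasDerivAt_pow (2 * k + 1) x).const_mul
        ((-1 / 2 : ℝ) ^ k / (k.factorial * (2 * k + 1)))).congr_deriv ?_
      have h1 : -(x ^ 2 / 2) = (-1 / 2) * x ^ 2 := by ring
      have h2 : (2 * (k : ℝ) + 1) ≠ 0 := by positivity
      rw [h1, mul_pow, ← pow_mul]
      push_cast
      field_simp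
    have h' : erfSeries n = fun x => ∑ k ∈ Finset.range n,
        (-1 / 2 : ℝ) ^ k / (k.factorial * (2 * k + 1)) * x ^ (2 * k + 1) := by
      funext x
      rw [erfSeries, Finset.mul_sum]
      refine Finset.sum_congr rfl fun k _ => ?_
      have h1 : -(x ^ 2 / 2) = (-1 / 2) * x ^ 2 := by ring
      rw [h1, mul_pow, ← pow_mul]
      ring
    rw [h']
    exact HasDerivAt.fun_sum fun k _ => h k
  have hd (x : ℝ) : HasDerivAt (fun x : ℝ => (-1 : ℝ) ^ n *
      ((∫ t in (0 : ℝ)..x, Real.exp (-(t ^ 2 / 2))) - erfSeries n x)) _ x :=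
    ((hasDerivAt_integral_exp_neg_half_sq x).sub (hs x)).const_mul ((-1 : ℝ) ^ n)
  have hmono : MonotoneOn (fun x : ℝ => (-1 : ℝ) ^ n *
      ((∫ t in (0 : ℝ)..x, Real.exp (-(t ^ 2 / 2))) - erfSeries n x)) (Set.Ici 0) := by
    refine monotoneOn_of_deriv_nonneg (convex_Ici 0)
      (fun x _ => (hd x).continuousAt.continuousWithinAt)
      (fun x _ => (hd x).differentiableAt.differentiableWithinAt) fun x _ => ?_
    rw [(hd x).deriv]
    exact alternating_exp_remainder_nonneg n (by positivity)
  have := hmono (Set.self_mem_Ici) hx hx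
  simpa [erfSeries] using this

lemma inv_sqrt_two_pi_bounds :
    0.39894228 < (√(2 * Real.pi))⁻¹ ∧ (√(2 * Real.pi))⁻¹ < 0.398942281 := by
  have h1 := Real.pi_gt_d20
  have h2 := Real.pi_lt_d20
  constructor
  · rw [lt_inv_comm₀ (by norm_num) (by positivity), Real.sqrt_lt' (by norm_num)]
    norm_num at h2 ⊢
    linarith
  · rw [inv_lt_comm₀ (by positivity) (by norm_num)]
    refine Real.lt_sqrt_of_sq_lt ?_
    norm_num at h1 ⊢
    linarith

lemma gaussTail_le_of_series {n : ℕ} (hn : Even n) {x s : ℝ} (hx : 0 ≤ x) (hs : 0 ≤ s)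
    (h : s ≤ erfSeries n x) : gaussTail x ≤ 1 / 2 - 0.39894228 * s := by
  have h1 := alternating_erfSeries_remainder_nonneg n hx
  rw [hn.neg_one_pow, one_mul] at h1
  have h2 := inv_sqrt_two_pi_bounds.1
  rw [gaussTail]
  have := mul_le_mul h2.le (h.trans (sub_nonneg.1 h1)) hs (by positivity)
  linarith

lemma le_gaussTail_of_series {n : ℕ} (hn : Odd n) {x s : ℝ} (hx : 0 ≤ x)
    (h : erfSeries n x ≤ s) : 1 / 2 - 0.398942281 * s ≤ gaussTail x := by
  have h1 := alternating_erfSeries_remainder_nonneg n hx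
  rw [hn.neg_one_pow] at h1
  have h2 := inv_sqrt_two_pi_bounds.2
  rw [gaussTail]
  have h3 : 0 ≤ ∫ t in (0 : ℝ)..x, Real.exp (-(t ^ 2 / 2)) :=
    intervalIntegral.integral_nonneg hx fun t _ => Real.exp_nonneg _
  have := mul_le_mul h2.le (show _ ≤ s by linarith) h3 (by norm_num)
  linarith

lemma gaussTail_two_bounds : 0.0227501 < gaussTail 2 ∧ gaussTail 2 < 0.0227502 := by
  constructor
  · refine lt_of_lt_of_le ?_ (le_gaussTail_of_series (n := 17) (by decide) (by norm_num)
      (s := 1.1962880134) ?_)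
    · norm_num
    · norm_num [erfSeries, Finset.sum_range_succ, Nat.factorial]
  · refine lt_of_le_of_lt (gaussTail_le_of_series (n := 16) (by decide) (by norm_num)
      (s := 1.196288013) (by norm_num) ?_) ?_
    · norm_num [erfSeries, Finset.sum_range_succ, Nat.factorial]
    · norm_num

lemma gaussTail_sqrt_two_bounds : 0.078649 < gaussTail (√2) ∧ gaussTail (√2) < 0.07865 := by
  have h1 : (1.4142135 : ℝ) < √2 := Real.lt_sqrt_of_sq_lt (by norm_num)
  have h2 : √2 < 1.4142136 := (Real.sqrt_lt' (by norm_num)).2 (by norm_num)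
  have h3 : (√2) ^ 2 = 2 := Real.sq_sqrt (by norm_num)
  constructor
  · refine lt_of_lt_of_le ?_ (le_gaussTail_of_series (n := 13) (by decide) (by positivity)
      (s := 1.4142136 * 0.746824133) ?_)
    · norm_num
    · rw [erfSeries, h3]
      refine mul_le_mul h2.le ?_ ?_ (by norm_num) <;>
      norm_num [Finset.sum_range_succ, Nat.factorial]
  · refine lt_of_le_of_lt (gaussTail_le_of_series (n := 12) (by decide) (by positivity)
      (s := 1.4142135 * 0.746824132) (by norm_num) ?_) ?_
    · rw [erfSeries, h3]
      refine mul_le_mul h1.le ?_ (by norm_num) (by positivity)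
      norm_num [Finset.sum_range_succ, Nat.factorial]
    · norm_num

/-- The tails at 1.59, 1.66 and 1.7321 (just above `√3`) determine the constant 3.55: times 3.55
they exceed `1 / (2 * 1.59 ^ 2)`, 0.1715 and 0.1477 respectively. -/
lemma le_gaussTail_159 : 0.05591 ≤ gaussTail (159 / 100) := by
  refine le_trans ?_ (le_gaussTail_of_series (n := 13) (by decide) (by norm_num) (s := 1.11316) ?_)
  · norm_num
  · norm_num [erfSeries, Finset.sum_range_succ, Nat.factorial]

lemma le_gaussTail_166 : 0.04845 ≤ gaussTail (166 / 100) := by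
  refine le_trans ?_ (le_gaussTail_of_series (n := 13) (by decide) (by norm_num) (s := 1.13186) ?_)
  · norm_num
  · norm_num [erfSeries, Finset.sum_range_succ, Nat.factorial]

lemma le_gaussTail_17321 : 0.04162 ≤ gaussTail (17321 / 10000) := by
  refine le_trans ?_ (le_gaussTail_of_series (n := 13) (by decide) (by norm_num) (s := 1.14898) ?_)
  · norm_num
  · norm_num [erfSeries, Finset.sum_range_succ, Nat.factorial]

/-- The level is `3 - 2 * 0.339`, reached when the fifth largest weight is at most 0.339. -/
lemma gaussTail_2322_le : gaussTail (2322 / 1000) ≤ 0.01014 := by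
  refine (gaussTail_le_of_series (n := 16) (by decide) (by norm_num) (s := 1.22792) (by norm_num)
    ?_).trans ?_
  · norm_num [erfSeries, Finset.sum_range_succ, Nat.factorial]
  · norm_num

lemma gaussTail_1912_le : gaussTail (1912 / 1000) ≤ 0.02796 := by
  refine (gaussTail_le_of_series (n := 16) (by decide) (by norm_num) (s := 1.18325) (by norm_num)
    ?_).trans ?_
  · norm_num [erfSeries, Finset.sum_range_succ, Nat.factorial]
  · norm_num

lemma gaussTail_2259_le : gaussTail (2259 / 1000) ≤ 0.01197 := by
  refine (gaussTail_le_of_series (n := 16) (by decide) (by norm_num) (s := 1.22335) (by norm_num)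
    ?_).trans ?_
  · norm_num [erfSeries, Finset.sum_range_succ, Nat.factorial]
  · norm_num

/-! ### Comparison of signed sums with the Gaussian tail -/

/-- `θ ^ 2 * gaussTail θ` is at least its value at `1.59` when `√2 ≤ θ ≤ 1.59`. -/
lemma one_le_sq_mul_gaussTail {θ : ℝ} (h1 : √2 ≤ θ) (h2 : θ ≤ 159 / 100) :
    1 ≤ 71 / 10 * θ ^ 2 * gaussTail θ := by
  set κ := (√(2 * Real.pi))⁻¹ with hκ
  have hκ0 : 0 < κ := by positivity
  have h2' : (√2) ^ 2 = 2 := Real.sq_sqrt (by norm_num)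
  have h141 : (1.4142 : ℝ) < √2 := Real.lt_sqrt_of_sq_lt (by norm_num)
  have hexp (x : ℝ) : HasDerivAt (fun x : ℝ => Real.exp (-(x ^ 2 / 2)))
      (Real.exp (-(x ^ 2 / 2)) * (-x)) x := by
    refine (((hasDerivAt_pow 2 x).div_const 2).neg.exp).congr_deriv ?_
    simp
  -- Up to the factor `-x`, this is the derivative of `x ^ 2 * gaussTail x`. It increases while `x ^
  -- 2 ≤ 3` and is already nonnegative at `√2`.
  have hd1 (x : ℝ) : HasDerivAt
      (fun x : ℝ => κ * (x * Real.exp (-(x ^ 2 / 2))) - 2 * gaussTail x)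
      (κ * ((3 - x ^ 2) * Real.exp (-(x ^ 2 / 2)))) x := by
    refine ((((hasDerivAt_id x).mul (hexp x)).const_mul κ).sub
      ((hasDerivAt_gaussTail x).const_mul 2)).congr_deriv ?_
    simp only [id, ← hκ]
    ring
  have hmono : MonotoneOn (fun x : ℝ => κ * (x * Real.exp (-(x ^ 2 / 2))) - 2 * gaussTail x)
      (Set.Icc (√2) (159 / 100)) := by
    refine monotoneOn_of_deriv_nonneg (convex_Icc _ _)
      (fun x _ => (hd1 x).continuousAt.continuousWithinAt)
      (fun x _ => (hd1 x).differentiableAt.differentiableWithinAt) fun x hx => ?_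
    rw [(hd1 x).deriv]
    have hx := interior_subset hx
    have : 0 ≤ 3 - x ^ 2 := by nlinarith [hx.1, hx.2]
    positivity
  have hstart : 0 ≤ κ * (√2 * Real.exp (-((√2) ^ 2 / 2))) - 2 * gaussTail (√2) := by
    rw [h2', div_self (by norm_num)]
    have h3 : (0.36 : ℝ) ≤ Real.exp (-1) := by
      have := Real.exp_neg_one_gt_d9; linarith
    have h4 := inv_sqrt_two_pi_bounds.1
    have h5 : (1.4142 : ℝ) * 0.36 ≤ √2 * Real.exp (-1) :=
      mul_le_mul h141.le h3 (by norm_num) (by positivity)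
    have h6 : (0.39894228 : ℝ) * (1.4142 * 0.36) ≤ κ * (√2 * Real.exp (-1)) :=
      mul_le_mul h4.le h5 (by norm_num) hκ0.le
    have := gaussTail_sqrt_two_bounds.2
    norm_num at h6 this ⊢
    linarith
  have hd2 (x : ℝ) : HasDerivAt (fun x : ℝ => x ^ 2 * gaussTail x)
      (-(x * (κ * (x * Real.exp (-(x ^ 2 / 2))) - 2 * gaussTail x))) x := by
    refine ((hasDerivAt_pow 2 x).mul (hasDerivAt_gaussTail x)).congr_deriv ?_
    simp only [← hκ]
    norm_num
    ring
  have hanti : AntitoneOn (fun x : ℝ => x ^ 2 * gaussTail x) (Set.Icc (√2) (159 / 100)) := by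
    refine antitoneOn_of_deriv_nonpos (convex_Icc _ _)
      (fun x _ => (hd2 x).continuousAt.continuousWithinAt)
      (fun x _ => (hd2 x).differentiableAt.differentiableWithinAt) fun x hx => ?_
    rw [(hd2 x).deriv]
    have hx := interior_subset hx
    have h7 := hmono (Set.left_mem_Icc.2 (hx.1.trans hx.2)) hx hx.1
    have hx0 : 0 ≤ x := by linarith [hx.1]
    have := mul_nonneg hx0 (hstart.trans h7)
    linarith
  have h8 := hanti ⟨h1, h2⟩ (Set.right_mem_Icc.2 (h1.trans h2)) h2
  have h9 := le_gaussTail_159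
  simp only at h8
  nlinarith

/-- The Gaussian comparison for signed sums at levels between `√2` and `√3` standard deviations. -/
lemma signProb_ge_le_gaussTail_of_le_sqrt_three {l : List ℝ} {r θ : ℝ} (hr : 0 < r)
    (hl : powSum 2 l ≤ r ^ 2) (h1 : √2 * r ≤ θ) (h2 : θ ≤ √3 * r) :
    signProb l {s | θ ≤ s} ≤ 71 / 20 * gaussTail (θ / r) := by
  have hθ : 0 < θ := lt_of_lt_of_le (by positivity) h1
  have h1' : √2 ≤ θ / r := (le_div_iff₀ hr).2 h1
  have h2' : θ / r ≤ √3 := (div_le_iff₀ hr).2 h2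
  have h0 := powSum_nonneg even_two l
  have hcheb := signProb_ge_le_sq l hθ
  -- Chebyshev suffices up to 1.59. On `[1.59, 1.66]` and `[1.66, √3]` the moment bound at the left
  -- end is compared with the Gaussian tail at the right end.
  rcases le_or_gt (θ / r) (159 / 100) with h | h
  · have h3 := one_le_sq_mul_gaussTail h1' h
    rw [div_pow] at h3
    calc _ ≤ _ := hcheb
      _ ≤ r ^ 2 / (2 * θ ^ 2) := by gcongr
      _ ≤ r ^ 2 / (2 * θ ^ 2) * (71 / 10 * (θ ^ 2 / r ^ 2) * gaussTail (θ / r)) :=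
        le_mul_of_one_le_right (by positivity) h3
      _ = _ := by field_simp; ring
  rcases h0.eq_or_lt with h0 | h0
  · rw [← h0, zero_div] at hcheb
    have := gaussTail_nonneg (θ / r)
    linarith
  -- Normalising by the actual standard deviation `q ≤ r` can only raise the level.
  set q := √(powSum 2 l) with hq
  have hq0 : 0 < q := Real.sqrt_pos.2 h0
  have hqr : q ≤ r := by
    rw [hq, Real.sqrt_le_left hr.le]; exact hl
  have hq2 : q ^ 2 = powSum 2 l := Real.sq_sqrt h0.le
  have hunit : powSum 2 (l.map (q⁻¹ * ·)) = 1 := by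
    rw [powSum_map_mul, ← hq2, ← mul_pow, inv_mul_cancel₀ hq0.ne', one_pow]
  have hscale : signProb (l.map (q⁻¹ * ·)) {s | q⁻¹ * θ ≤ s} = signProb l {s | θ ≤ s} :=
    signProb_map_mul l (inv_pos.2 hq0) θ
  have hle : θ / r ≤ q⁻¹ * θ := by
    rw [inv_mul_eq_div]
    gcongr
  rw [← hscale]
  rcases le_or_gt (θ / r) (166 / 100) with h' | h'
  · have h3 := signProb_ge_le_of_159 hunit (h.le.trans hle)
    have h4 := le_gaussTail_166.trans (antitone_gaussTail h')
    norm_num at h3 h4 ⊢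
    linarith
  · have h3 := signProb_ge_le_of_166 hunit (h'.le.trans hle)
    have h5 : √3 ≤ 17321 / 10000 := (Real.sqrt_le_left (by norm_num)).2 (by norm_num)
    have h4 := le_gaussTail_17321.trans (antitone_gaussTail (h2'.trans h5))
    norm_num at h3 h4 ⊢
    linarith

/-- Both sides vanish at 0, and comparing derivatives reduces to a nonnegative multiple of `x ^ 4`.
-/
lemma two_mul_div_le_log_ratio {z : ℝ} (h0 : 0 ≤ z) (h1 : z < 1) :
    2 * z / (1 - z ^ 2 / 3) ≤ Real.log (1 + z) - Real.log (1 - z) := by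
  have hd (x : ℝ) (hx0 : 0 ≤ x) (hx1 : x < 1) :
      HasDerivAt (fun z : ℝ => Real.log (1 + z) - Real.log (1 - z) - 2 * z / (1 - z ^ 2 / 3))
      (1 / (1 + x) - (-1) / (1 - x) -
        (2 * (1 - x ^ 2 / 3) - 2 * x * (-(2 * x / 3))) / (1 - x ^ 2 / 3) ^ 2) x := by
    have hne : 1 - x ^ 2 / 3 ≠ 0 := by nlinarith
    have e1 : HasDerivAt (fun z : ℝ => 1 + z) 1 x := (hasDerivAt_id x).const_add 1
    have e2 : HasDerivAt (fun z : ℝ => 1 - z) (-1) x := (hasDerivAt_id x).const_sub 1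
    have e3 : HasDerivAt (fun z : ℝ => 2 * z) 2 x := by
      simpa using (hasDerivAt_id x).const_mul 2
    have e4 : HasDerivAt (fun z : ℝ => 1 - z ^ 2 / 3) (-(2 * x / 3)) x := by
      have := ((hasDerivAt_pow 2 x).div_const 3).const_sub 1
      simpa using this
    exact ((e1.log (by linarith)).sub (e2.log (by linarith))).sub (e3.div e4 hne)
  have hmono : MonotoneOn
      (fun z : ℝ => Real.log (1 + z) - Real.log (1 - z) - 2 * z / (1 - z ^ 2 / 3))
      (Set.Ico 0 1) := by
    refine monotoneOn_of_deriv_nonneg (convex_Ico _ _)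
      (fun x hx => (hd x hx.1 hx.2).continuousAt.continuousWithinAt)
      (fun x hx => (hd x (interior_subset hx).1
        (interior_subset hx).2).differentiableAt.differentiableWithinAt) fun x hx => ?_
    obtain ⟨hx0, hx1⟩ := interior_subset hx
    rw [(hd x hx0 hx1).deriv]
    have p1 : 0 < 1 - x ^ 2 / 3 := by nlinarith
    have p2 : 0 < 1 - x := by linarith
    have p3 : 0 < 1 + x := by linarith
    have : 1 / (1 + x) - (-1) / (1 - x) = 2 / ((1 + x) * (1 - x)) := by field_simp; ring
    rw [this, sub_nonneg, div_le_div_iff₀ (by positivity) (by positivity)]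
    nlinarith [sq_nonneg (x ^ 2)]
  have := hmono ⟨le_rfl, one_pos⟩ ⟨h0, h1⟩ h0
  simp only [add_zero, Real.log_one, sub_zero, mul_zero, zero_div] at this
  linarith

/-- Replacing a centred Gaussian component by a Rademacher one of the same variance does not
increase the tail beyond `√3` standard deviations. -/
lemma gaussTail_add_gaussTail_le {x τ : ℝ} (hx : 3 ≤ x ^ 2) (hx0 : 0 ≤ x) (h0 : 0 ≤ τ)
    (h1 : τ < 1) :
    gaussTail ((x - τ) / √(1 - τ ^ 2)) + gaussTail ((x + τ) / √(1 - τ ^ 2)) ≤ 2 * gaussTail x := by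
  set κ := (√(2 * Real.pi))⁻¹ with hκ
  have hκ0 : 0 < κ := by positivity
  have hd (ε t : ℝ) (hε : ε ^ 2 = 1) (ht0 : 0 ≤ t) (ht1 : t < 1) :
      HasDerivAt (fun t : ℝ => gaussTail ((x + ε * t) / √(1 - t ^ 2)))
      (-(κ * Real.exp (-(((x + ε * t) / √(1 - t ^ 2)) ^ 2 / 2))) *
        ((ε + x * t) / ((1 - t ^ 2) * √(1 - t ^ 2)))) t := by
    have hp : 0 < 1 - t ^ 2 := by nlinarith
    have hs : 0 < √(1 - t ^ 2) := Real.sqrt_pos.2 hp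
    have hs2 : √(1 - t ^ 2) ^ 2 = 1 - t ^ 2 := Real.sq_sqrt hp.le
    have e1 : HasDerivAt (fun t : ℝ => x + ε * t) ε t := by
      simpa using ((hasDerivAt_id t).const_mul ε).const_add x
    have e2 : HasDerivAt (fun t : ℝ => 1 - t ^ 2) (-(2 * t)) t := by
      simpa using (hasDerivAt_pow 2 t).const_sub 1
    refine ((hasDerivAt_gaussTail _).comp t (e1.div (e2.sqrt hp.ne') hs.ne')).congr_deriv ?_
    rw [← hκ]
    congr 1
    rw [hs2]
    field_simp
    rw [hs2]
    ring
  have hanti : AntitoneOn (fun t : ℝ => gaussTail ((x + (-1) * t) / √(1 - t ^ 2)) +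
      gaussTail ((x + 1 * t) / √(1 - t ^ 2))) (Set.Ico 0 1) := by
    refine antitoneOn_of_deriv_nonpos (convex_Ico _ _)
      (fun t ht => ((hd (-1) t (by norm_num) ht.1 ht.2).add
        (hd 1 t (by norm_num) ht.1 ht.2)).continuousAt.continuousWithinAt)
      (fun t ht => ((hd (-1) t (by norm_num) (interior_subset ht).1 (interior_subset ht).2).add
        (hd 1 t (by norm_num) (interior_subset ht).1
          (interior_subset ht).2)).differentiableAt.differentiableWithinAt) fun t ht => ?_
    obtain ⟨ht0, ht1⟩ := interior_subset ht
    have hder := ((hd (-1) t (by norm_num) ht0 ht1).add (hd 1 t (by norm_num) ht0 ht1)).deriv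
    refine hder.trans_le ?_
    have hp : 0 < 1 - t ^ 2 := by nlinarith
    have hs : 0 < √(1 - t ^ 2) := Real.sqrt_pos.2 hp
    have hs2 : √(1 - t ^ 2) ^ 2 = 1 - t ^ 2 := Real.sq_sqrt hp.le
    have hxt : 0 ≤ x * t := mul_nonneg hx0 ht0
    set A := (x + (-1) * t) / √(1 - t ^ 2) with hA
    set B := (x + 1 * t) / √(1 - t ^ 2) with hB
    have hdiff : A ^ 2 / 2 = B ^ 2 / 2 - 2 * (x * t) / (1 - t ^ 2) := by
      rw [hA, hB, div_pow, div_pow, hs2]; field_simp; ring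
    -- This is the sign of the derivative in `t`. With `z = x * t`, the hypothesis `3 ≤ x ^ 2` gives
    -- `t ^ 2 ≤ z ^ 2 / 3`, which is exactly what the logarithmic inequality needs.
    have key : Real.exp (-(A ^ 2 / 2)) * (1 - x * t) ≤ Real.exp (-(B ^ 2 / 2)) * (1 + x * t) := by
      rcases le_or_gt 1 (x * t) with h | h
      · exact (mul_nonpos_of_nonneg_of_nonpos (Real.exp_nonneg _) (by linarith)).trans
          (by positivity)
      have hlog := two_mul_div_le_log_ratio hxt h
      have hle : 2 * (x * t) / (1 - t ^ 2) ≤ 2 * (x * t) / (1 - (x * t) ^ 2 / 3) := by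
        have : 0 < 1 - (x * t) ^ 2 / 3 := by nlinarith
        have : t ^ 2 ≤ (x * t) ^ 2 / 3 := by
          rw [mul_pow]; nlinarith [mul_le_mul_of_nonneg_right hx (sq_nonneg t)]
        gcongr
      have hA' : -(A ^ 2 / 2) = -(B ^ 2 / 2) + 2 * (x * t) / (1 - t ^ 2) := by linarith
      rw [hA', Real.exp_add, mul_assoc]
      refine mul_le_mul_of_nonneg_left ?_ (Real.exp_nonneg _)
      have h1z : 0 < 1 - x * t := by linarith
      rw [← le_div_iff₀ h1z, ← Real.le_log_iff_exp_le (by positivity),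
        Real.log_div (by positivity) h1z.ne']
      exact hle.trans hlog
    have hfac : -(κ * Real.exp (-(A ^ 2 / 2))) * ((-1 + x * t) / ((1 - t ^ 2) * √(1 - t ^ 2))) +
        -(κ * Real.exp (-(B ^ 2 / 2))) * ((1 + x * t) / ((1 - t ^ 2) * √(1 - t ^ 2))) =
        κ / ((1 - t ^ 2) * √(1 - t ^ 2)) *
          (Real.exp (-(A ^ 2 / 2)) * (1 - x * t) - Real.exp (-(B ^ 2 / 2)) * (1 + x * t)) := by
      ring
    rw [hfac]
    exact mul_nonpos_of_nonneg_of_nonpos (by positivity) (by linarith)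
  have := hanti ⟨le_rfl, one_pos⟩ ⟨h0, h1⟩ h0
  simp only [mul_zero, add_zero, ne_eq, OfNat.ofNat_ne_zero, not_false_eq_true, zero_pow, sub_zero,
    Real.sqrt_one, div_one, one_mul, neg_mul, ← sub_eq_add_neg] at this
  linarith

/-- A Gaussian tail bound for signed sums: `P(S ≥ θ) ≤ 3.55 (1 - Φ(θ / r))` whenever
`Var S ≤ r²` and `θ ≥ √2 r`. -/
theorem signProb_ge_le_gaussTail {l : List ℝ} {r θ : ℝ} (hr : 0 < r)
    (hl : powSum 2 l ≤ r ^ 2) (h1 : √2 * r ≤ θ) :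
    signProb l {s | θ ≤ s} ≤ 71 / 20 * gaussTail (θ / r) := by
  induction l generalizing r θ with
  | nil =>
    have hθ : 0 < θ := lt_of_lt_of_le (by positivity) h1
    have := gaussTail_nonneg (θ / r)
    have h2 : signProb [] {s | θ ≤ s} = 0 := by
      rw [signProb, signAvg_nil]; simp [hθ]
    rw [h2]
    positivity
  | cons a l ih =>
    rcases le_or_gt θ (√3 * r) with h2 | h2
    · exact signProb_ge_le_gaussTail_of_le_sqrt_three hr hl h1 h2
    have hθ : 0 < θ := lt_of_lt_of_le (by positivity) h1
    have h3r : 3 * r ^ 2 ≤ θ ^ 2 := by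
      have := pow_le_pow_left₀ (by positivity) h2.le 2
      rwa [mul_pow, Real.sq_sqrt (by norm_num)] at this
    rw [powSum_cons] at hl
    have hl0 := powSum_nonneg even_two l
    set τ := |a| with hτ
    have hτ0 : 0 ≤ τ := abs_nonneg a
    have hτa : τ ^ 2 = a ^ 2 := sq_abs a
    have hcons : signProb (a :: l) {s | θ ≤ s} =
        (signProb l {s | θ - τ ≤ s} + signProb l {s | θ + τ ≤ s}) / 2 := by
      have h (c : ℝ) : {s : ℝ | c + s ∈ {s | θ ≤ s}} = {s | θ - c ≤ s} := by
        ext s; simp only [Set.mem_ofPred_eq, sub_le_iff_le_add']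
      rw [signProb_cons, h a, h (-a), hτ]
      rcases abs_choice a with h | h <;> rw [h] <;> ring_nf
    have hτr : τ ≤ r := (pow_le_pow_iff_left₀ hτ0 hr.le two_ne_zero).1 (by linarith)
    have hrθ : r < θ := by
      by_contra! h
      nlinarith [pow_le_pow_left₀ hθ.le h 2]
    rw [hcons]
    -- If one weight exhausts the variance, the others vanish and `θ > r` is out of reach.
    rcases hτr.eq_or_lt with hτr | hτr
    · have hl' : powSum 2 l = 0 := by rw [hτr] at hτa; linarith
      have h3 := signProb_ge_le_sq l (θ := θ - τ) (by linarith)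
      have h4 := signProb_ge_le_sq l (θ := θ + τ) (by linarith)
      rw [hl', zero_div] at h3 h4
      have := gaussTail_nonneg (θ / r)
      linarith
    · have hpos : 0 < r ^ 2 - τ ^ 2 := by nlinarith
      set r' := √(r ^ 2 - τ ^ 2) with hr'
      have hr'0 : 0 < r' := Real.sqrt_pos.2 hpos
      have hr'2 : r' ^ 2 = r ^ 2 - τ ^ 2 := Real.sq_sqrt hpos.le
      -- Since `3 * r ^ 2 ≤ θ ^ 2`, the difference of squares is at least `(θ - 3 * τ) ^ 2 / 3`.
      -- Thus both conditioned problems stay beyond `√2` standard deviations.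
      have h5 : √2 * r' ≤ θ - τ := by
        refine (pow_le_pow_iff_left₀ (by positivity) (by linarith) two_ne_zero).1 ?_
        rw [mul_pow, Real.sq_sqrt (by norm_num), hr'2]
        nlinarith [sq_nonneg (θ - 3 * τ)]
      have h3 := ih hr'0 (by linarith) h5
      have h4 := ih hr'0 (by linarith) (h5.trans (by linarith : θ - τ ≤ θ + τ))
      have h6 : √(1 - (τ / r) ^ 2) = r' / r := by
        rw [← Real.sqrt_sq (by positivity : 0 ≤ r' / r), div_pow, div_pow, hr'2]
        congr 1
        field_simp
      have h7 := gaussTail_add_gaussTail_le (x := θ / r) (τ := τ / r)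
        (by rw [div_pow, le_div_iff₀ (by positivity)]; exact h3r) (by positivity) (by positivity)
        ((div_lt_one hr).2 hτr)
      rw [h6, ← sub_div, ← add_div, div_div_div_cancel_right₀ hr.ne',
        div_div_div_cancel_right₀ hr.ne'] at h7
      linarith

/-! ### Stopped walks -/

lemma signProb_cons_abs_le (a x : ℝ) (l : List ℝ) :
    signProb (a :: l) {s | |x + s| ≤ 1} =
      (signProb l {s | |x + a + s| ≤ 1} + signProb l {s | |x - a + s| ≤ 1}) / 2 := by
  rw [signProb_cons]
  simp only [Set.mem_ofPred_eq, add_assoc, sub_eq_add_neg]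

lemma signProb_cons_le_abs (a x m : ℝ) (l : List ℝ) :
    signProb (a :: l) {s | m ≤ |x + s|} =
      (signProb l {s | m ≤ |x + a + s|} + signProb l {s | m ≤ |x - a + s|}) / 2 := by
  rw [signProb_cons]
  simp only [Set.mem_ofPred_eq, add_assoc, sub_eq_add_neg]

lemma signProb_abs_le_neg (l : List ℝ) (x : ℝ) :
    signProb l {s | |-x + s| ≤ 1} = signProb l {s | |x + s| ≤ 1} := by
  rw [← signProb_neg]
  congr 1
  ext s
  rw [Set.mem_ofPred_eq, Set.mem_ofPred_eq, Set.mem_ofPred_eq, ← abs_neg]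
  ring_nf

lemma signProb_pos_le (l : List ℝ) : signProb l {s | 0 < s} ≤ 1 / 2 := by
  have h1 := signProb_add_compl l {s | 0 < s}
  have h2 : signProb l {s | -s ∈ {s : ℝ | 0 < s}} ≤ signProb l {s | 0 < s}ᶜ :=
    signProb_mono l fun s hs => by
      simp only [Set.mem_ofPred_eq, Set.mem_compl_iff, not_lt] at hs ⊢
      linarith
  rw [signProb_neg] at h2
  linarith

/-- The reflection bound: a walk at `x ∈ [-1, 1]` ends in `[-1, 1]` with probability at least `1/2`
up to a tail probability of the remaining increment. -/
lemma half_sub_le_signProb (l : List ℝ) {x : ℝ} (hx : |x| ≤ 1) :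
    1 / 2 - signProb l {s | 1 + |x| ≤ s} ≤ signProb l {s | |x + s| ≤ 1} := by
  wlog h0 : 0 ≤ x generalizing x
  · have := this (x := -x) (by rwa [abs_neg]) (by linarith)
    rwa [signProb_abs_le_neg, abs_neg] at this
  rw [abs_of_nonneg h0] at hx ⊢
  have h1 := signProb_add_compl l {s | |x + s| ≤ 1}
  have h2 : signProb l {s | |x + s| ≤ 1}ᶜ ≤
      signProb l ({s | 0 < s} ∪ {s | -s ∈ {s | 1 + x ≤ s}}) := signProb_mono l fun s hs => by
    simp only [Set.mem_ofPred_eq, Set.mem_compl_iff, Set.mem_union, not_le] at hs ⊢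
    rcases lt_abs.1 hs with h | h
    · left; linarith
    · right; linarith
  have h3 := signProb_union_le l {s | 0 < s} {s | -s ∈ {s | 1 + x ≤ s}}
  rw [signProb_neg] at h3
  linarith [signProb_pos_le l]

/-- The step towards the origin stays inside. -/
lemma half_le_signProb_singleton {a x : ℝ} (hx : |x| ≤ 1) (h0 : 0 ≤ a) (h1 : a ≤ 1) :
    1 / 2 ≤ signProb [a] {s | |x + s| ≤ 1} := by
  wlog hx0 : 0 ≤ x generalizing x
  · have := this (x := -x) (by rwa [abs_neg]) (by linarith)
    rwa [signProb_abs_le_neg] at this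
  rw [signProb_cons_abs_le]
  have h2 : signProb [] {s | |x - a + s| ≤ 1} = 1 := by
    have : |x - a| ≤ 1 := by
      rw [abs_of_nonneg hx0] at hx
      rw [abs_le]; constructor <;> linarith
    simp [signProb, this]
  have := signProb_nonneg [] {s | |x + a + s| ≤ 1}
  rw [h2]
  linarith

/-- For `x ≥ 0`: if `x + b ≤ 1`, both values of the first step stay inside and the single-step bound
applies. Otherwise `-a` is good for either sign of `b`; `a + 2 * b ≤ 2` prevents an exit on the
left. -/
lemma half_le_signProb_pair {a b x : ℝ} (hx : |x| ≤ 1) (hb : 0 ≤ b) (hba : b ≤ a) (ha : a ≤ 1)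
    (hab : a + 2 * b ≤ 2) : 1 / 2 ≤ signProb [b, a] {s | |x + s| ≤ 1} := by
  wlog hx0 : 0 ≤ x generalizing x
  · have := this (x := -x) (by rwa [abs_neg]) (by linarith)
    rwa [signProb_abs_le_neg] at this
  rw [abs_of_nonneg hx0] at hx
  rcases le_or_gt (x + b) 1 with h | h
  · rw [signProb_cons_abs_le]
    have h1 := half_le_signProb_singleton (a := a) (x := x + b)
      (by rw [abs_le]; constructor <;> linarith) (hb.trans hba) ha
    have h2 := half_le_signProb_singleton (a := a) (x := x - b)
      (by rw [abs_le]; constructor <;> linarith) (hb.trans hba) ha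
    linarith
  · rw [signProb_cons_abs_le, signProb_cons_abs_le, signProb_cons_abs_le]
    have h1 : signProb [] {s | |x + b - a + s| ≤ 1} = 1 := by
      have : |x + b - a| ≤ 1 := by rw [abs_le]; constructor <;> linarith
      simp [signProb, this]
    have h2 : signProb [] {s | |x - b - a + s| ≤ 1} = 1 := by
      have : |x - b - a| ≤ 1 := by rw [abs_le]; constructor <;> linarith
      simp [signProb, this]
    have h3 := signProb_nonneg [] {s | |x + b + a + s| ≤ 1}
    have h4 := signProb_nonneg [] {s | |x - b + a + s| ≤ 1}
    rw [h1, h2]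
    linarith

/-- Stopping a walk with steps at most `v` once it leaves `[-(1 - v), 1 - v]`, and bounding all
losses at once by a tail probability of the whole walk. -/
lemma half_sub_le_signProb_of_le {R l : List ℝ} {v : ℝ}
    (hR : ∀ x : ℝ, |x| ≤ 1 → 1 / 2 ≤ signProb R {s | |x + s| ≤ 1})
    (hl : ∀ a ∈ l, 0 ≤ a ∧ a ≤ v) {x : ℝ} (hx : |x| ≤ 1) :
    1 / 2 - signProb (l ++ R) {s | 3 - 2 * v ≤ |x + s|} ≤
      signProb (l ++ R) {s | |x + s| ≤ 1} := by
  induction l generalizing x with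
  | nil =>
    have := hR x hx
    have := signProb_nonneg R {s | 3 - 2 * v ≤ |x + s|}
    rw [List.nil_append]
    linarith
  | cons a l ih =>
    rcases lt_or_ge (1 - v) |x| with h | h
    · have h1 := half_sub_le_signProb (a :: l ++ R) hx
      -- An outward increment of `1 + |x|` puts the end point beyond `1 + 2 * |x| > 3 - 2 * v`. Up
      -- to symmetry the loss is thus an event of the final position, so losses from different
      -- stopping places merge into one tail.
      have h2 : signProb (a :: l ++ R) {s | 1 + |x| ≤ s} ≤
          signProb (a :: l ++ R) {s | 3 - 2 * v ≤ |x + s|} := by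
        rcases le_total 0 x with h0 | h0
        · refine signProb_mono _ fun s hs => ?_
          rw [abs_of_nonneg h0] at hs h
          simp only [Set.mem_ofPred_eq] at hs ⊢
          exact (by linarith : 3 - 2 * v ≤ x + s).trans (le_abs_self _)
        · rw [← signProb_neg]
          refine signProb_mono _ fun s hs => ?_
          rw [abs_of_nonpos h0] at hs h
          simp only [Set.mem_ofPred_eq] at hs ⊢
          exact (by linarith : 3 - 2 * v ≤ -(x + s)).trans (neg_le_abs _)
      linarith
    · obtain ⟨ha0, hav⟩ := hl a List.mem_cons_self
      obtain ⟨h1, h2⟩ := abs_le.1 h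
      have hl' : ∀ b ∈ l, 0 ≤ b ∧ b ≤ v := fun b hb => hl b (List.mem_cons_of_mem _ hb)
      have h3 := ih hl' (x := x + a) (by rw [abs_le]; constructor <;> linarith)
      have h4 := ih hl' (x := x - a) (by rw [abs_le]; constructor <;> linarith)
      rw [List.cons_append, signProb_cons_abs_le, signProb_cons_le_abs]
      linarith

/-- Stopping a walk with steps at most `v` once it leaves `[-(1 - v), 1 - v]`, and bounding each
loss by the Gaussian tail. -/
lemma half_sub_gaussTail_le_signProb {R l : List ℝ} {v r : ℝ}
    (hR : ∀ x : ℝ, |x| ≤ 1 → 1 / 2 ≤ signProb R {s | |x + s| ≤ 1})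
    (hl : ∀ a ∈ l, 0 ≤ a ∧ a ≤ v) (hr : 0 < r) (hlr : powSum 2 (l ++ R) ≤ r ^ 2)
    (hv : √2 * r ≤ 2 - v) {x : ℝ} (hx : |x| ≤ 1) :
    1 / 2 - 71 / 20 * gaussTail ((2 - v) / r) ≤ signProb (l ++ R) {s | |x + s| ≤ 1} := by
  induction l generalizing x with
  | nil =>
    have := hR x hx
    have := gaussTail_nonneg ((2 - v) / r)
    rw [List.nil_append]
    linarith
  | cons a l ih =>
    rcases lt_or_ge (1 - v) |x| with h | h
    · have h1 := half_sub_le_signProb (a :: l ++ R) hx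
      have h2 : signProb (a :: l ++ R) {s | 1 + |x| ≤ s} ≤
          signProb (a :: l ++ R) {s | 2 - v ≤ s} := signProb_mono _ fun s hs => by
        simp only [Set.mem_ofPred_eq] at hs ⊢
        linarith
      have h3 := signProb_ge_le_gaussTail hr hlr hv
      linarith
    · obtain ⟨ha0, hav⟩ := hl a List.mem_cons_self
      obtain ⟨h1, h2⟩ := abs_le.1 h
      have hl' : ∀ b ∈ l, 0 ≤ b ∧ b ≤ v := fun b hb => hl b (List.mem_cons_of_mem _ hb)
      rw [List.cons_append, powSum_cons] at hlr
      have hlr' : powSum 2 (l ++ R) ≤ r ^ 2 := by linarith [sq_nonneg a]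
      have h3 := ih hl' hlr' (x := x + a) (by rw [abs_le]; constructor <;> linarith)
      have h4 := ih hl' hlr' (x := x - a) (by rw [abs_le]; constructor <;> linarith)
      rw [List.cons_append, signProb_cons_abs_le]
      linarith

lemma sqrt_two_mul_div_le {w t : ℝ} (hw : 0 ≤ w) (ht : 1.5 ≤ t) : √2 * (w / t) ≤ w := by
  have h1 : √2 ≤ 1.5 := (Real.sqrt_le_left (by norm_num)).2 (by norm_num)
  rw [← mul_div_assoc, div_le_iff₀ (by linarith), mul_comm]
  exact mul_le_mul_of_nonneg_left (h1.trans ht) hw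

/-- The bound when the fifth largest weight is small. -/
lemma signProb_abs_le_one_of_small {a b : ℝ} {l R : List ℝ} (ha : 0 ≤ a) (hb : 0 ≤ b)
    (hab : a + b ≤ 1) (hl : ∀ c ∈ l, 0 ≤ c ∧ c ≤ 339 / 1000)
    (hR : ∀ x : ℝ, |x| ≤ 1 → 1 / 2 ≤ signProb R {s | |x + s| ≤ 1})
    (hsq : powSum 2 (a :: b :: (l ++ R)) ≤ 1) :
    1 / 2 - 0.0723 ≤ signProb (a :: b :: (l ++ R)) {s | |0 + s| ≤ 1} := by
  -- The first two steps cannot leave `[-1, 1]`, so they need no stopping rule. The total loss is at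
  -- most `7.1 * 0.01014 < 0.0723`.
  have key (x : ℝ) (hx : |x| ≤ 1) := half_sub_le_signProb_of_le hR hl hx
  have h1 := key (0 + a + b) (by rw [abs_le]; constructor <;> linarith)
  have h2 := key (0 + a - b) (by rw [abs_le]; constructor <;> linarith)
  have h3 := key (0 - a + b) (by rw [abs_le]; constructor <;> linarith)
  have h4 := key (0 - a - b) (by rw [abs_le]; constructor <;> linarith)
  have h5 : 1 / 2 - signProb (a :: b :: (l ++ R)) {s | 3 - 2 * (339 / 1000) ≤ |0 + s|} ≤
      signProb (a :: b :: (l ++ R)) {s | |0 + s| ≤ 1} := by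
    rw [signProb_cons_abs_le, signProb_cons_abs_le, signProb_cons_abs_le, signProb_cons_le_abs,
      signProb_cons_le_abs, signProb_cons_le_abs]
    linarith
  have h6 : {s : ℝ | 3 - 2 * (339 / 1000) ≤ |0 + s|} = {s | 2322 / 1000 ≤ |s|} := by
    ext s; norm_num
  have hs2 : √2 ≤ 2322 / 1000 := (Real.sqrt_le_left (by norm_num)).2 (by norm_num)
  have h7 := signProb_ge_le_gaussTail (l := a :: b :: (l ++ R)) (r := 1) (θ := 2322 / 1000)
    one_pos (by rwa [one_pow]) (by rwa [mul_one])
  have h8 := gaussTail_2322_le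
  rw [h6, signProb_abs _ (by norm_num)] at h5
  rw [div_one] at h7
  norm_num at h5 h7 h8 ⊢
  linarith

/-- The bound when the five largest weights are large. -/
lemma signProb_abs_le_one_of_large {a b c z : ℝ} {l R : List ℝ} (hba : b ≤ a) (hcb : c ≤ b)
    (hzc : z ≤ c) (hz : 0 ≤ z) (hc : 339 / 1000 ≤ c) (hab : a + b ≤ 1)
    (hl : ∀ d ∈ l, 0 ≤ d ∧ d ≤ z)
    (hR : ∀ x : ℝ, |x| ≤ 1 → 1 / 2 ≤ signProb R {s | |x + s| ≤ 1})
    (hsq : powSum 2 (a :: b :: c :: z :: (l ++ R)) ≤ 1) :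
    1 / 2 - 0.0723 ≤ signProb (a :: b :: c :: z :: (l ++ R)) {s | |0 + s| ≤ 1} := by
  simp only [powSum_cons] at hsq
  have hpos := powSum_nonneg even_two (l ++ R)
  have hc2 : (339 / 1000) ^ 2 ≤ c ^ 2 := by gcongr
  have hb2 : (339 / 1000) ^ 2 ≤ b ^ 2 := by gcongr; exact hc.trans hcb
  have ha2 : (339 / 1000) ^ 2 ≤ a ^ 2 := by gcongr; exact (hc.trans hcb).trans hba
  have hz1 : z ≤ 1 / 2 := by linarith
  -- From `a + b` the walk stops at once. The worst case is `a = b = 0.339`, where `(1 + a + b) /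
  -- √(1 - a ^ 2 - b ^ 2)` is just above 1.912.
  have h1 : 1 / 2 - 71 / 20 * gaussTail (1912 / 1000) ≤
      signProb (c :: z :: (l ++ R)) {s | |a + b + s| ≤ 1} := by
    have hx0 : 0 < 1 + (a + b) := by linarith
    have h2 := half_sub_le_signProb (c :: z :: (l ++ R)) (x := a + b)
      (by rw [abs_le]; constructor <;> linarith)
    rw [abs_of_nonneg (by linarith)] at h2
    have h3 := signProb_ge_le_gaussTail (l := c :: z :: (l ++ R))
      (r := (1 + (a + b)) / (1912 / 1000)) (θ := 1 + (a + b))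
      (by positivity) (by
        simp only [powSum_cons]
        rw [div_pow, le_div_iff₀ (by norm_num)]
        nlinarith [sq_nonneg (a - b)])
      (sqrt_two_mul_div_le hx0.le (by norm_num))
    rw [div_div_cancel₀ hx0.ne'] at h3
    linarith
  -- The remaining variance is at most `K - z ^ 2` with `K = 1 - 3 * 0.339 ^ 2`. The ratio `(2 - z)
  -- / √(K - z ^ 2)` is smallest at `z = K / 2 ≈ 0.3276`, where it just exceeds 2.259.
  have h2 (x : ℝ) (hx : |x| ≤ 1) : 1 / 2 - 71 / 20 * gaussTail (2259 / 1000) ≤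
      signProb (l ++ R) {s | |x + s| ≤ 1} := by
    have hz0 : 0 < 2 - z := by linarith
    have h3 := half_sub_gaussTail_le_signProb hR hl (r := (2 - z) / (2259 / 1000))
      (by positivity) (by
        rw [div_pow, le_div_iff₀ (by norm_num)]
        nlinarith [sq_nonneg (z - 0.3276)])
      (sqrt_two_mul_div_le hz0.le (by norm_num)) hx
    rwa [div_div_cancel₀ hz0.ne'] at h3
  have h3 : 1 / 2 - 71 / 20 * gaussTail (2259 / 1000) ≤
      signProb (c :: z :: (l ++ R)) {s | |a - b + s| ≤ 1} := by
    rw [signProb_cons_abs_le, signProb_cons_abs_le, signProb_cons_abs_le]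
    have h4 := h2 (a - b + c + z) (by rw [abs_le]; constructor <;> linarith)
    have h5 := h2 (a - b + c - z) (by rw [abs_le]; constructor <;> linarith)
    have h6 := h2 (a - b - c + z) (by rw [abs_le]; constructor <;> linarith)
    have h7 := h2 (a - b - c - z) (by rw [abs_le]; constructor <;> linarith)
    linarith
  -- By symmetry the starts `±(a + b)` and `±(a - b)` have weight `1/2` each, so the loss is at most
  -- `3.55 * (0.02796 + 0.01197) / 2 < 0.0723`.
  rw [signProb_cons_abs_le, signProb_cons_abs_le b, signProb_cons_abs_le b]
  have e1 : (0 : ℝ) - a + b = -(a - b) := by ring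
  have e2 : (0 : ℝ) - a - b = -(a + b) := by ring
  rw [e1, e2, signProb_abs_le_neg, signProb_abs_le_neg, zero_add]
  have h8 := gaussTail_1912_le
  have h9 := gaussTail_2259_le
  norm_num at h1 h3 h8 h9 ⊢
  linarith

/-- Taking alternate weights makes the constraints free: sorting gives `a₂ ^ 2 + a₄ ^ 2 ≤ 1 / 2`, so
`a₂ + a₄ ≤ 1`, and `a₁ ^ 2 + 2 * a₃ ^ 2 ≤ 1`, so `a₁ + 2 * a₃ ≤ √3 < 2`. The threshold 0.339 for
`a₅` balances the two cases. -/
lemma signProb_abs_le_one_of_sorted {a₁ a₂ a₃ a₄ a₅ a₆ : ℝ} {l : List ℝ} (h1 : a₂ ≤ a₁)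
    (h2 : a₃ ≤ a₂) (h3 : a₄ ≤ a₃) (h4 : a₅ ≤ a₄) (h5 : a₆ ≤ a₅) (h6 : 0 ≤ a₆)
    (hl : ∀ d ∈ l, 0 ≤ d ∧ d ≤ a₆) (hsq : powSum 2 (a₁ :: a₂ :: a₃ :: a₄ :: a₅ :: a₆ :: l) ≤ 1) :
    1 / 2 - 0.0723 ≤ signProb (a₁ :: a₂ :: a₃ :: a₄ :: a₅ :: a₆ :: l) {s | |s| ≤ 1} := by
  have hperm : (a₁ :: a₂ :: a₃ :: a₄ :: a₅ :: a₆ :: l).Perm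
      (a₂ :: a₄ :: a₅ :: a₆ :: (l ++ [a₃, a₁])) := by
    have e : (a₁ :: a₂ :: a₃ :: a₄ :: a₅ :: a₆ :: l).Perm
        (a₃ :: a₁ :: ([a₂, a₄, a₅, a₆] ++ l)) := by
      rw [← Multiset.coe_eq_coe]
      simp only [List.cons_append, List.nil_append, ← Multiset.cons_coe]
      rw [Multiset.cons_swap a₃ a₁, Multiset.cons_swap a₃ a₂]
    have e2 := List.perm_append_comm (l₁ := [a₃, a₁]) (l₂ := [a₂, a₄, a₅, a₆] ++ l)
    refine e.trans (e2.trans ?_)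
    simp
  rw [powSum_perm hperm] at hsq
  have hsum : a₁ ^ 2 + a₂ ^ 2 + a₃ ^ 2 + a₄ ^ 2 ≤ 1 := by
    rw [← powSum_perm hperm] at hsq
    simp only [powSum_cons] at hsq
    have := powSum_nonneg even_two l
    nlinarith [sq_nonneg a₅, sq_nonneg a₆]
  have h24 : a₂ + a₄ ≤ 1 := by
    have e1 : a₂ ^ 2 ≤ a₁ ^ 2 := pow_le_pow_left₀ (by linarith) h1 2
    have e2 : a₄ ^ 2 ≤ a₃ ^ 2 := pow_le_pow_left₀ (by linarith) h3 2
    by_contra! h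
    nlinarith [sq_nonneg (a₂ - a₄)]
  have ha1 : a₁ ≤ 1 := by nlinarith [sq_nonneg a₂, sq_nonneg a₃, sq_nonneg a₄]
  have h13 : a₁ + 2 * a₃ ≤ 2 := by
    have e1 : a₃ ^ 2 ≤ a₂ ^ 2 := pow_le_pow_left₀ (by linarith) h2 2
    by_contra! h
    nlinarith [sq_nonneg (a₁ - a₃), sq_nonneg a₄]
  have hR (x : ℝ) (hx : |x| ≤ 1) : 1 / 2 ≤ signProb [a₃, a₁] {s | |x + s| ≤ 1} :=
    half_le_signProb_pair hx (by linarith) (by linarith) ha1 h13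
  rw [signProb, signAvg_perm hperm]
  change _ ≤ signProb _ _
  have e0 : {s : ℝ | |s| ≤ 1} = {s | |0 + s| ≤ 1} := by simp
  rw [e0]
  rcases le_total a₅ (339 / 1000) with h | h
  · refine signProb_abs_le_one_of_small (l := a₅ :: a₆ :: l) (by linarith) (by linarith) h24
      (fun c hc => ?_) hR hsq
    rcases List.mem_cons.1 hc with rfl | hc
    · exact ⟨by linarith, h⟩
    rcases List.mem_cons.1 hc with rfl | hc
    · exact ⟨by linarith, by linarith⟩
    · exact ⟨(hl c hc).1, by linarith [(hl c hc).2]⟩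
  · exact signProb_abs_le_one_of_large (by linarith) h4 h5 h6 h h24 hl hR hsq

/-! ### Reduction to sorted nonnegative weights -/

lemma signProb_zero_cons (l : List ℝ) (A : Set ℝ) : signProb (0 :: l) A = signProb l A := by
  rw [signProb_cons]; simp

lemma signProb_replicate_zero_append (n : ℕ) (l : List ℝ) (A : Set ℝ) :
    signProb (List.replicate n 0 ++ l) A = signProb l A := by
  induction n with
  | zero => simp
  | succ n ih => rw [List.replicate_succ, List.cons_append, signProb_zero_cons, ih]

lemma powSum_replicate_zero_append (n : ℕ) (l : List ℝ) :
    powSum 2 (List.replicate n 0 ++ l) = powSum 2 l := by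
  induction n with
  | zero => simp
  | succ n ih => rw [List.replicate_succ, List.cons_append, powSum_cons, ih]; simp

/-- At least a proportion `0.4277` of the signed sums of a vector in the unit ball lie in
`[-1, 1]`. -/
theorem signProb_abs_le_one {l : List ℝ} (hl : powSum 2 l ≤ 1) :
    1 / 2 - 0.0723 ≤ signProb l {s | |s| ≤ 1} := by
  -- Six zeros guarantee that the six largest weights exist, without changing the distribution.
  set L := List.replicate 6 0 ++ l.map (|·|) with hL
  have hLnonneg : ∀ a ∈ L, 0 ≤ a := fun a ha => by
    rcases List.mem_append.1 ha with h | h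
    · rw [List.eq_of_mem_replicate h]
    · obtain ⟨b, -, rfl⟩ := List.mem_map.1 h
      exact abs_nonneg b
  have hP : signProb L {s | |s| ≤ 1} = signProb l {s | |s| ≤ 1} := by
    rw [hL, signProb_replicate_zero_append, signProb, signAvg_map_abs, ← signProb]
  have hsq : powSum 2 L ≤ 1 := by
    rw [hL, powSum_replicate_zero_append, powSum_map_abs]; exact hl
  have hlen : 6 ≤ L.length := by simp [hL]
  have hperm : (L.insertionSort (· ≥ ·)).Perm L := List.perm_insertionSort _ L
  have hsort := List.pairwise_insertionSort (· ≥ ·) L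
  rw [← hperm.length_eq] at hlen
  rw [← powSum_perm hperm] at hsq
  rw [← hP, signProb, ← signAvg_perm hperm, ← signProb]
  have hnn : ∀ a ∈ L.insertionSort (· ≥ ·), 0 ≤ a := fun a ha => hLnonneg a (hperm.mem_iff.1 ha)
  generalize L.insertionSort (· ≥ ·) = M at *
  match M, hlen with
  | a₁ :: a₂ :: a₃ :: a₄ :: a₅ :: a₆ :: t, _ =>
    simp only [List.pairwise_cons, List.mem_cons, forall_eq_or_imp] at hsort hnn
    exact signProb_abs_le_one_of_sorted hsort.1.1 hsort.2.1.1 hsort.2.2.1.1 hsort.2.2.2.1.1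
      hsort.2.2.2.2.1.1 hnn.2.2.2.2.2.1
      (fun d hd => ⟨hnn.2.2.2.2.2.2 d hd, hsort.2.2.2.2.2.1 d hd⟩) hsq

/-! ### From random variables to signed sums -/

lemma measure_preimage_of_hasLaw_rademacher {Ω : Type*} [MeasurableSpace Ω] {P : Measure Ω}
    {X : Ω → ℝ} (hX : HasLaw X rademacherMeasure P) :
    P (X ⁻¹' {1}) = 2⁻¹ ∧ P (X ⁻¹' {-1}) = 2⁻¹ ∧ ∀ᵐ ω ∂P, X ω = 1 ∨ X ω = -1 := by
  have hm (A : Set ℝ) (hA : MeasurableSet A) : P (X ⁻¹' A) = rademacherMeasure A := by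
    rw [← hX.map_eq, Measure.map_apply_of_aemeasurable hX.aemeasurable hA]
  refine ⟨?_, ?_, ?_⟩
  · rw [hm _ (measurableSet_singleton _), rademacherMeasure]
    norm_num [Set.indicator]
  · rw [hm _ (measurableSet_singleton _), rademacherMeasure]
    norm_num [Set.indicator]
  · have hA : MeasurableSet ({1, -1} : Set ℝ)ᶜ := by measurability
    have := hm _ hA
    rw [rademacherMeasure] at this
    have h0 : P (X ⁻¹' ({1, -1} : Set ℝ)ᶜ) = 0 := by rw [this]; simp
    rw [ae_iff]
    convert h0 using 2
    ext ω
    simp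

/-- The law of a Rademacher sum is the distribution of the signed sums of its weights. -/
lemma measureReal_sum_eq_signProb {Ω : Type*} [MeasurableSpace Ω] (P : Measure Ω)
    [IsProbabilityMeasure P] {n : ℕ} (v : Fin n → ℝ) (ε : Fin n → Ω → ℝ)
    (hlaw : ∀ i, HasLaw (ε i) rademacherMeasure P) (hindep : iIndepFun ε P) {A : Set ℝ}
    (hA : MeasurableSet A) :
    P.real {ω | ∑ i, v i * ε i ω ∈ A} = signProb (List.ofFn v) A := by
  induction n generalizing A with
  | zero =>
    by_cases h : (0 : ℝ) ∈ A <;> simp [signProb, h]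
  | succ n ih =>
    have hlaw' : ∀ i : Fin n, HasLaw (ε i.succ) rademacherMeasure P := fun i => hlaw _
    have hindep' : iIndepFun (fun i : Fin n => ε i.succ) P :=
      hindep.precomp (Fin.succ_injective n)
    set S : Ω → ℝ := fun ω => ∑ i : Fin n, v i.succ * ε i.succ ω with hS
    have hind : IndepFun (ε 0) S P := by
      have h := hindep.indepFun_finset₀ {0} (Finset.univ.image Fin.succ) (by
        rw [Finset.disjoint_singleton_left]; simp)
        fun i => (hlaw i).aemeasurable
      have m1 : Measurable fun x : ↥({0} : Finset (Fin (n + 1))) → ℝ =>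
          x ⟨0, Finset.mem_singleton_self 0⟩ := measurable_pi_apply _
      have m2 : Measurable
          fun x : ↥(Finset.univ.image (Fin.succ : Fin n → Fin (n + 1))) → ℝ =>
            ∑ i : Fin n, v i.succ * x ⟨i.succ, Finset.mem_image_of_mem _ (Finset.mem_univ i)⟩ :=
        Finset.measurable_fun_sum _ fun i _ => (measurable_pi_apply _).const_mul _
      exact h.comp m1 m2
    obtain ⟨hp, hm, hae⟩ := measure_preimage_of_hasLaw_rademacher (hlaw 0)
    have hmeas (c : ℝ) : MeasurableSet {s : ℝ | c + s ∈ A} := (measurable_const_add c) hA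
    have hpart (c : ℝ) (hc : P (ε 0 ⁻¹' {c}) = 2⁻¹) (d : ℝ) :
        P.real (ε 0 ⁻¹' {c} ∩ S ⁻¹' {s | d + s ∈ A}) =
          signProb (List.ofFn fun i : Fin n => v i.succ) {s | d + s ∈ A} / 2 := by
      rw [measureReal_def, hind.measure_inter_preimage_eq_mul _ _ (measurableSet_singleton c)
        (hmeas d), hc, ENNReal.toReal_mul, ← ih (fun i => v i.succ) _ hlaw' hindep' (hmeas d),
        div_eq_inv_mul]
      simp [measureReal_def, hS, Set.preimage]
    have hSm : AEMeasurable S P := by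
      refine Finset.aemeasurable_fun_sum _ fun i _ => ?_
      exact (hlaw i.succ).aemeasurable.const_mul _
    -- Condition on the first sign; the two cases cover everything only up to the null set where `ε
    -- 0` is neither 1 nor -1.
    have hsplit : ({ω | ∑ i, v i * ε i ω ∈ A} : Set Ω) =ᵐ[P]
        (((ε 0 ⁻¹' {1} ∩ S ⁻¹' {s | v 0 + s ∈ A}) ∪
          (ε 0 ⁻¹' {-1} ∩ S ⁻¹' {s | -v 0 + s ∈ A}) : Set Ω)) := by
      filter_upwards [hae] with ω hω
      refine propext ?_
      change (∑ i, v i * ε i ω ∈ A) ↔ (ε 0 ω = 1 ∧ v 0 + S ω ∈ A) ∨ (ε 0 ω = -1 ∧ -v 0 + S ω ∈ A)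
      rw [Fin.sum_univ_succ]
      rcases hω with h | h <;> rw [h] <;> norm_num [hS]
    rw [measureReal_congr hsplit, measureReal_union₀ ?_ ?_, hpart 1 hp, hpart (-1) hm,
      List.ofFn_succ, signProb_cons, add_div]
    · exact ((hlaw 0).aemeasurable.nullMeasurable (measurableSet_singleton _)).inter
        (hSm.nullMeasurable (hmeas _))
    · refine Disjoint.aedisjoint ?_
      rw [Set.disjoint_left]
      rintro ω ⟨h1, -⟩ ⟨h2, -⟩
      simp only [Set.mem_preimage, Set.mem_singleton_iff] at h1 h2
      rw [h1] at h2
      norm_num at h2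

lemma powSum_two_ofFn {n : ℕ} (v : Fin n → ℝ) : powSum 2 (List.ofFn v) = ∑ i, v i ^ 2 := by
  rw [powSum, List.map_ofFn, List.sum_ofFn]
  rfl

/-! ### The value of `G(1/4)` and the conclusion -/

lemma boundG_quarter :
    boundG (1 / 4) = 1 / 2 - (1 - stdNormalCDF 2) / (4 * (1 - stdNormalCDF (√2))) := by
  have h : ((1 / 4 : ℝ)) ^ (-(1 / 2) : ℝ) = 2 := by
    rw [Real.rpow_neg (by norm_num), ← Real.sqrt_eq_rpow,
      show (1 / 4 : ℝ) = (1 / 2) ^ 2 by norm_num, Real.sqrt_sq (by norm_num)]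
    norm_num
  rw [boundG, h]
  have h2 : 1 - stdNormalCDF (√2) ≠ 0 := by
    rw [one_sub_stdNormalCDF]
    have := gaussTail_sqrt_two_bounds.1
    norm_num at this
    linarith
  field_simp
  ring

lemma boundG_quarter_bounds : 0.42768 < boundG (1 / 4) ∧ boundG (1 / 4) < 0.42769 := by
  rw [boundG_quarter, one_sub_stdNormalCDF, one_sub_stdNormalCDF]
  obtain ⟨h1, h2⟩ := gaussTail_two_bounds
  obtain ⟨h3, h4⟩ := gaussTail_sqrt_two_bounds
  have h0 : 0 < 4 * gaussTail (√2) := by linarith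
  constructor
  · have : gaussTail 2 / (4 * gaussTail (√2)) < 0.07232 := by
      rw [div_lt_iff₀ h0]; linarith
    linarith
  · have : 0.07231 < gaussTail 2 / (4 * gaussTail (√2)) := by
      rw [lt_div_iff₀ h0]; linarith
    linarith

theorem theorem1 {Ω : Type*} [MeasurableSpace Ω] (P : Measure Ω) [IsProbabilityMeasure P]
    (n : ℕ) (v : Fin n → ℝ) (hv : ∑ i, v i ^ 2 ≤ 1)
    (ε : Fin n → Ω → ℝ) (hlaw : ∀ i, HasLaw (ε i) rademacherMeasure P)
    (hindep : iIndepFun ε P) :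
    P.real {ω | |∑ i, v i * ε i ω| ≤ 1} ≥ boundG (1 / 4) ∧
    boundG (1 / 4) = 1 / 2 - (1 - stdNormalCDF 2) / (4 * (1 - stdNormalCDF (√2))) ∧
    (0.42768 < boundG (1 / 4) ∧ boundG (1 / 4) < 0.42769) := by
  refine ⟨?_, boundG_quarter, boundG_quarter_bounds⟩
  have hA : MeasurableSet {s : ℝ | |s| ≤ 1} := measurableSet_le (by fun_prop) measurable_const
  have h1 := measureReal_sum_eq_signProb P v ε hlaw hindep hA
  have h2 := signProb_abs_le_one (l := List.ofFn v) (by rwa [powSum_two_ofFn])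
  rw [← h1] at h2
  -- The walk estimate gives 0.4277, which exceeds the upper bound 0.42769 for `G(1/4)`.
  have h3 := boundG_quarter_bounds.2
  simp only [Set.mem_ofPred_eq] at h2
  norm_num at h2 h3 ⊢
  linarith
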